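/- Let $X$ be a finite set. A concept class over the domain $X$ is a set $C$ of functions $c : X \to \{0,1\}$. A labeled sample over $X$ is a set $S \subseteq X \times \{0,1\}$; its size is $|S|$. It is $C$-realizable if there is a $c \in C$ with $c(x) = b$ for all $(x,b) \in S$. Let $\mathrm{SMN}'(C)$ denote the smallest integer $d \ge 0$ such that the number of $C$-realizable labeled samples of size at most $d$ is greater than or equal to $|C|$. For integers $k \ge 2$ and $n$ with $k \le 2^n$, let $C_{k,n} = \{c_0, c_1, \ldots, c_{k-1}\}$ be the concept class over the $n$-point domain $\{x_0, \ldots, x_{n-1}\}$ for which $c_i(x_j)$ is the $j$-th bit of the binary representation of $i$, i.e. $i = \sum_{j=0}^{n-1} c_i(x_j)\, 2^j$ for $0 \le i \le k-1$. Corollary. Let $k \ge 2$ and $n \ge \log_2 k$ be integers. Among all concept classes $C$ with $|C| = k$ over a domain of size $n$, the parameter $\mathrm{SMN}'(C)$ is maximized by $C = C_{k,n}$. That is, $C_{k,n}$ consists of exactly $k$ concepts over an $n$-point domain, and $\mathrm{SMN}'(C) \le \mathrm{SMN}'(C_{k,n})$ for every concept class $C$ with $|C| = k$ over a domain of size $n$.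 -/

import Mathlib

/-- A concept class over the domain `X` is a finite set of concepts `X → {0,1}`. -/
abbrev ConceptClass (X : Type*) := Finset (X → Bool)

/-- A labeled sample of size `m` is a set of `m` distinct elements of `X × {0,1}`. -/
abbrev LabeledSample (X : Type*) := Finset (X × Bool)

/-- The concept `c` is consistent with the labeled sample `S`. -/
def Consistent {X : Type*} (c : X → Bool) (S : LabeledSample X) : Prop :=
  ∀ p ∈ S, c p.1 = p.2

/-- The labeled sample `S` is realizable by `C`. -/
def Realizable {X : Type*} (C : ConceptClass X) (S : LabeledSample X) : Prop :=
  ∃ c ∈ C, Consistent c S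

/-- The `C`-realizable samples of size at most `d`. -/
def realizableSamples {X : Type*} (C : ConceptClass X) (d : ℕ) : Set (LabeledSample X) :=
  {S | Realizable C S ∧ S.card ≤ d}

/-- `SMN'(C)`: the smallest `d` such that the number of `C`-realizable samples of size
at most `d` is at least `|C|`. -/
noncomputable def smnPrime {X : Type*} [Fintype X] (C : ConceptClass X) : ℕ :=
  sInf {d : ℕ | C.card ≤ (realizableSamples C d).ncard}

/-- The minimum in the definition of `SMN'(C)` is attained (so no junk value occurs). -/
theorem smnPrime_isLeast {X : Type*} [Fintype X] (C : ConceptClass X) :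
    IsLeast {d : ℕ | C.card ≤ (realizableSamples C d).ncard} (smnPrime C) := by
  classical
  refine ⟨Nat.sInf_mem ⟨Fintype.card X, ?_⟩, fun d hd => Nat.sInf_le hd⟩
  let g : (X → Bool) → LabeledSample X := fun c => Finset.univ.image fun x => (x, c x)
  have hg : Function.Injective g := by
    intro c c' h
    funext x
    have hx : (x, c x) ∈ g c := Finset.mem_image_of_mem _ (Finset.mem_univ x)
    rw [h] at hx
    obtain ⟨y, -, hy⟩ := Finset.mem_image.1 hx
    have h1 : y = x := congrArg Prod.fst hy
    have h2 : c' y = c x := congrArg Prod.snd hy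
    rw [← h2, h1]
  have hsub : ((C.image g : Finset (LabeledSample X)) : Set (LabeledSample X)) ⊆
      realizableSamples C (Fintype.card X) := by
    intro S hS
    obtain ⟨c, hc, rfl⟩ := Finset.mem_image.1 (Finset.mem_coe.1 hS)
    refine ⟨⟨c, hc, ?_⟩, Finset.card_image_le⟩
    intro p hp
    obtain ⟨x, -, rfl⟩ := Finset.mem_image.1 hp
    rfl
  have h := Set.ncard_le_ncard hsub (Set.toFinite _)
  rw [Set.ncard_coe_finset, Finset.card_image_of_injective _ hg] at h
  exact h

/-- Membership in the `(k,n)`-family: `|C| = k` and `|dom(C)| = n`. -/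
def InFamily (k n : ℕ) {X : Type*} [Fintype X] (C : ConceptClass X) : Prop :=
  C.card = k ∧ Fintype.card X = n

/-- The binary-counting class `C_{k,n} = {c_0, …, c_{k-1}}` over `{x_0, …, x_{n-1}}`:
`c_i(x_j)` is the `j`-th bit (least significant first) of `i`. -/
def binaryCountingClass (k n : ℕ) : ConceptClass (Fin n) :=
  (Finset.range k).image fun i => fun j : Fin n => i.testBit j

/-!
For a class `C`, the number of realizable samples of size at most `d` is bounded below by a sum
`∑ i < |C|, w (s₂ i)`, where `s₂ i` is the binary digit sum of `i` and `w s` is the number of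
sets of size at most `d` containing a fixed `s`-element set; for the binary counting class this
bound is attained. Hence the binary counting class has the fewest realizable samples of each
bounded size, and `SMN'` is largest for it.

Both bounds come from one recursion on the set `T` of points that a sample may use
(`ncard_samplesOn_insert`): a sample over `T ∪ {x}` either avoids `x`, or it labels `x` by some
`b` and the rest is a sample over `T` realizable by the subclass `{c ∈ C | c x = b}`. If the two
subclasses have sizes `a ≥ b`, the lower bound for `a + b` reduces to
`∑ i < a + b, w (s₂ i) ≤ ∑ i < a, w (s₂ i) + ∑ i < b, w (s₂ i + 1)` for antitone `w`
(`weightSum_add_le`), which is proved by halving `a` and `b`. For the binary counting class split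
at its top bit this inequality is an equality (`weightSum_add_of_le_two_pow`).
-/

/-! ### Weighted binary digit sums -/

/-- The number of ones in the binary expansion of `i`. -/
def binarySum (i : ℕ) : ℕ := (Nat.digits 2 i).sum

theorem binarySum_two_mul (i : ℕ) : binarySum (2 * i) = binarySum i := by
  rcases Nat.eq_zero_or_pos i with rfl | hi
  · rfl
  · simpa [binarySum] using congrArg List.sum
      (Nat.digits_add 2 (by norm_num) 0 i (by norm_num) (Or.inr hi.ne'))

theorem binarySum_two_mul_add_one (i : ℕ) : binarySum (2 * i + 1) = binarySum i + 1 := by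
  have h := congrArg List.sum
    (Nat.digits_add 2 (by norm_num) 1 i (by norm_num) (Or.inl (by norm_num)))
  rw [List.sum_cons] at h
  unfold binarySum
  rw [add_comm (2 * i), h, add_comm]

theorem binarySum_two_pow_add {m i : ℕ} (hi : i < 2 ^ m) :
    binarySum (2 ^ m + i) = binarySum i + 1 := by
  induction m generalizing i with
  | zero =>
    obtain rfl : i = 0 := by simpa using hi
    simp [binarySum]
  | succ m ih =>
    rw [pow_succ] at hi ⊢
    obtain ⟨j, rfl | rfl⟩ := Nat.even_or_odd' i
    · rw [show 2 ^ m * 2 + 2 * j = 2 * (2 ^ m + j) by ring, binarySum_two_mul,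
        binarySum_two_mul, ih (by omega)]
    · rw [show 2 ^ m * 2 + (2 * j + 1) = 2 * (2 ^ m + j) + 1 by ring,
        binarySum_two_mul_add_one, binarySum_two_mul_add_one, ih (by omega)]

theorem binarySum_le {m i : ℕ} (hi : i < 2 ^ m) : binarySum i ≤ m := by
  induction m generalizing i with
  | zero =>
    obtain rfl : i = 0 := by simpa using hi
    simp [binarySum]
  | succ m ih =>
    rw [pow_succ] at hi
    obtain ⟨j, rfl | rfl⟩ := Nat.even_or_odd' i
    · rw [binarySum_two_mul]
      exact (ih (by omega)).trans m.le_succ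
    · rw [binarySum_two_mul_add_one]
      exact Nat.succ_le_succ (ih (by omega))

/-- The total weight of the first `k` natural numbers, where `i` is weighted by `w` at its binary
digit sum. -/
def weightSum (w : ℕ → ℕ) (k : ℕ) : ℕ := ∑ i ∈ Finset.range k, w (binarySum i)

theorem weightSum_succ (w : ℕ → ℕ) (k : ℕ) :
    weightSum w (k + 1) = weightSum w k + w (binarySum k) :=
  Finset.sum_range_succ _ _

theorem weightSum_two_mul (w : ℕ → ℕ) (k : ℕ) :
    weightSum w (2 * k) = weightSum w k + weightSum (fun s => w (s + 1)) k := by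
  induction k with
  | zero => rfl
  | succ k ih =>
    rw [show 2 * (k + 1) = 2 * k + 1 + 1 by ring, weightSum_succ, weightSum_succ, weightSum_succ,
      weightSum_succ, binarySum_two_mul, binarySum_two_mul_add_one, ih]
    ring

theorem weightSum_two_mul_add_one (w : ℕ → ℕ) (k : ℕ) :
    weightSum w (2 * k + 1) = weightSum w (k + 1) + weightSum (fun s => w (s + 1)) k := by
  rw [weightSum_succ, weightSum_two_mul, weightSum_succ, binarySum_two_mul]
  ring

/-- Subadditivity of the weight sum with a unit shift on the smaller summand: the digit sums of
`a, …, a + b - 1` dominate those of `0, …, b - 1` increased by one. -/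
theorem weightSum_add_le {a b : ℕ} (hba : b ≤ a) {w : ℕ → ℕ} (hw : Antitone w) :
    weightSum w (a + b) ≤ weightSum w a + weightSum (fun s => w (s + 1)) b := by
  induction a using Nat.strong_induction_on generalizing b w with
  | _ a ih =>
    have hw' : Antitone fun s => w (s + 1) := fun s t h => hw (Nat.succ_le_succ h)
    rcases Nat.eq_zero_or_pos b with rfl | hb
    · simp [weightSum]
    obtain ⟨p, rfl | rfl⟩ := Nat.even_or_odd' a <;> obtain ⟨q, rfl | rfl⟩ := Nat.even_or_odd' b
    · have h1 := ih p (by omega) (b := q) (by omega) hw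
      have h2 := ih p (by omega) (b := q) (by omega) hw'
      rw [← mul_add]
      simp only [weightSum_two_mul]
      omega
    · have h1 := ih p (by omega) (b := q + 1) (by omega) hw
      have h2 := ih p (by omega) (b := q) (by omega) hw'
      rw [show 2 * p + (2 * q + 1) = 2 * (p + q) + 1 by ring]
      simp only [weightSum_two_mul, weightSum_two_mul_add_one]
      rw [← add_assoc] at h1
      omega
    · have h1 := ih (p + 1) (by omega) (b := q) (by omega) hw
      have h2 := ih p (by omega) (b := q) (by omega) hw'
      rw [show 2 * p + 1 + 2 * q = 2 * (p + q) + 1 by ring]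
      simp only [weightSum_two_mul, weightSum_two_mul_add_one]
      rw [show p + 1 + q = p + q + 1 by ring] at h1
      omega
    · rcases (show q ≤ p by omega).eq_or_lt with rfl | hqp
      · -- For `a = b` the claim is the halving identity.
        rw [← two_mul, weightSum_two_mul]
      · have h1 := ih (p + 1) (by omega) (b := q) (by omega) hw
        have h2 := ih p (by omega) (b := q + 1) (by omega) hw'
        rw [show 2 * p + 1 + (2 * q + 1) = 2 * (p + q + 1) by ring]
        simp only [weightSum_two_mul, weightSum_two_mul_add_one]
        rw [show p + 1 + q = p + q + 1 by ring] at h1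
        rw [← add_assoc] at h2
        -- The induction hypotheses give the term at `q` one shift higher than the halving does;
        -- that term is the smaller one since `w` is antitone.
        have h3 := weightSum_succ (fun s => w (s + 1)) q
        have h4 := weightSum_succ (fun s => w (s + 1 + 1)) q
        have h5 : w (binarySum q + 1 + 1) ≤ w (binarySum q + 1) := hw' (binarySum q).le_succ
        omega

theorem weightSum_add_of_le_two_pow {m b : ℕ} (hb : b ≤ 2 ^ m) (w : ℕ → ℕ) :
    weightSum w (2 ^ m + b) = weightSum w (2 ^ m) + weightSum (fun s => w (s + 1)) b := by
  unfold weightSum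
  rw [Finset.sum_range_add]
  congr 1
  refine Finset.sum_congr rfl fun i hi => ?_
  rw [binarySum_two_pow_add ((Finset.mem_range.1 hi).trans_le hb)]

/-! ### The number of small supersets -/

/-- The number of subsets with fewer than `e` elements of an `m`-element set. -/
def smallSubsets (m e : ℕ) : ℕ := ∑ j ∈ Finset.range e, m.choose j

theorem smallSubsets_mono {m m' e e' : ℕ} (hm : m ≤ m') (he : e ≤ e') :
    smallSubsets m e ≤ smallSubsets m' e' :=
  (Finset.sum_le_sum fun j _ => Nat.choose_le_choose j hm).trans
    (Finset.sum_le_sum_of_subset (Finset.range_mono he))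

theorem smallSubsets_succ_succ (m e : ℕ) :
    smallSubsets (m + 1) (e + 1) = smallSubsets m (e + 1) + smallSubsets m e := by
  unfold smallSubsets
  rw [Finset.sum_range_succ', Finset.sum_range_succ' (fun j => m.choose j)]
  simp only [Nat.choose_succ_succ, Finset.sum_add_distrib, Nat.choose_zero_right]
  ring

/-- The number of sets with fewer than `e` elements that contain a fixed `s`-element subset of an
`n`-element set. For `s ≥ e` the truncated subtraction gives the correct value `0`. -/
def smallSupersets (n e s : ℕ) : ℕ := smallSubsets (n - s) (e - s)

theorem smallSupersets_antitone (n e : ℕ) : Antitone (smallSupersets n e) := fun _ _ h =>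
  smallSubsets_mono (Nat.sub_le_sub_left h n) (Nat.sub_le_sub_left h e)

theorem smallSupersets_succ_succ_succ (n e s : ℕ) :
    smallSupersets (n + 1) (e + 1) (s + 1) = smallSupersets n e s := by
  simp [smallSupersets]

theorem smallSupersets_succ_succ {n s : ℕ} (hs : s ≤ n) (e : ℕ) :
    smallSupersets (n + 1) (e + 1) s = smallSupersets n (e + 1) s + smallSupersets n e s := by
  unfold smallSupersets
  rcases le_or_gt s e with h | h
  · rw [Nat.succ_sub hs, Nat.succ_sub h]
    exact smallSubsets_succ_succ _ _
  · rw [Nat.sub_eq_zero_of_le h, Nat.sub_eq_zero_of_le h.le]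
    simp [smallSubsets]

/-- The inequality in `smallSupersets_succ_succ` that also holds for the values at `s > n`. -/
theorem smallSupersets_succ_succ_le (n e s : ℕ) :
    smallSupersets (n + 1) (e + 1) s ≤ smallSupersets n (e + 1) s + smallSupersets n e s := by
  rcases le_or_gt s n with h | h
  · exact (smallSupersets_succ_succ h e).le
  · refine le_add_right (smallSubsets_mono ?_ le_rfl)
    omega

/-! ### Recursion for realizable samples -/

/-- The `C`-realizable samples with fewer than `e` elements whose points lie in `T`. -/
def samplesOn {X : Type*} (C : ConceptClass X) (T : Finset X) (e : ℕ) : Set (LabeledSample X) :=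
  {S | Realizable C S ∧ (∀ p ∈ S, p.1 ∈ T) ∧ S.card < e}

theorem finite_samplesOn {X : Type*} (C : ConceptClass X) (T : Finset X) (e : ℕ) :
    (samplesOn C T e).Finite := by
  classical
  refine (T ×ˢ (Finset.univ : Finset Bool)).powerset.finite_toSet.subset fun S hS => ?_
  simp only [Finset.mem_coe, Finset.mem_powerset]
  intro p hp
  simpa using hS.2.1 p hp

/-- A class whose traces on `T` all occur in `C'` has at most as many samples over `T`. -/
theorem ncard_samplesOn_le {X : Type*} {C C' : ConceptClass X} {T : Finset X}
    (h : ∀ c ∈ C, ∃ c' ∈ C', ∀ x ∈ T, c' x = c x) (e : ℕ) :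
    (samplesOn C T e).ncard ≤ (samplesOn C' T e).ncard := by
  refine Set.ncard_le_ncard ?_ (finite_samplesOn C' T e)
  rintro S ⟨⟨c, hc, hS⟩, hT, he⟩
  obtain ⟨c', hc', hcc'⟩ := h c hc
  exact ⟨⟨c', hc', fun p hp => (hcc' _ (hT p hp)).trans (hS p hp)⟩, hT, he⟩

theorem samplesOn_zero {X : Type*} (C : ConceptClass X) (T : Finset X) :
    samplesOn C T 0 = ∅ := by
  ext S
  simp [samplesOn]

theorem samplesOn_insert {X : Type*} [DecidableEq X] (C : ConceptClass X) {T : Finset X} {x : X}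
    (hx : x ∉ T) (e : ℕ) :
    samplesOn C (insert x T) (e + 1) = samplesOn C T (e + 1) ∪
      (insert (x, false) '' samplesOn (C.filter fun c => c x = false) T e ∪
        insert (x, true) '' samplesOn (C.filter fun c => c x = true) T e) := by
  have key : ∀ b : Bool, ∀ S : LabeledSample X, S ∈ samplesOn C (insert x T) (e + 1) →
      (x, b) ∈ S → S ∈ insert (x, b) '' samplesOn (C.filter fun c => c x = b) T e := by
    rintro b S ⟨⟨c, hc, hS⟩, hT, he⟩ hb
    refine ⟨S.erase (x, b), ⟨⟨c, ?_, ?_⟩, ?_, ?_⟩, Finset.insert_erase hb⟩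
    · exact Finset.mem_filter.2 ⟨hc, hS _ hb⟩
    · exact fun p hp => hS p (Finset.mem_of_mem_erase hp)
    · intro p hp
      have hp' := Finset.mem_of_mem_erase hp
      refine (Finset.mem_insert.1 (hT p hp')).resolve_left fun hpx => ?_
      -- A sample realized by `c` contains no second label of `x`.
      refine Finset.ne_of_mem_erase hp (Prod.ext hpx ?_)
      rw [← hS p hp', hpx]
      exact hS _ hb
    · rw [Finset.card_erase_of_mem hb]
      have := Finset.card_pos.2 ⟨_, hb⟩
      omega
  have key' : ∀ b : Bool, insert (x, b) '' samplesOn (C.filter fun c => c x = b) T e ⊆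
      samplesOn C (insert x T) (e + 1) := by
    rintro b _ ⟨S, ⟨⟨c, hc, hS⟩, hT, he⟩, rfl⟩
    rw [Finset.mem_filter] at hc
    refine ⟨⟨c, hc.1, ?_⟩, ?_, (Finset.card_insert_le _ _).trans_lt (by omega)⟩
    · intro p hp
      rcases Finset.mem_insert.1 hp with rfl | hp
      · exact hc.2
      · exact hS p hp
    · intro p hp
      rcases Finset.mem_insert.1 hp with rfl | hp
      · exact Finset.mem_insert_self _ _
      · exact Finset.mem_insert_of_mem (hT p hp)
  apply Set.Subset.antisymm
  · intro S hS
    by_cases h0 : (x, false) ∈ S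
    · exact Or.inr (Or.inl (key _ S hS h0))
    by_cases h1 : (x, true) ∈ S
    · exact Or.inr (Or.inr (key _ S hS h1))
    refine Or.inl ⟨hS.1, fun p hp => ?_, hS.2.2⟩
    refine (Finset.mem_insert.1 (hS.2.1 p hp)).resolve_left ?_
    rintro hpx
    obtain ⟨y, b⟩ := p
    obtain rfl : y = x := hpx
    cases b
    · exact h0 hp
    · exact h1 hp
  · refine Set.union_subset ?_ (Set.union_subset (key' false) (key' true))
    exact fun S hS => ⟨hS.1, fun p hp => Finset.mem_insert_of_mem (hS.2.1 p hp), hS.2.2⟩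

theorem ncard_samplesOn_insert {X : Type*} [DecidableEq X] (C : ConceptClass X) {T : Finset X}
    {x : X} (hx : x ∉ T) (e : ℕ) :
    (samplesOn C (insert x T) (e + 1)).ncard = (samplesOn C T (e + 1)).ncard +
      ((samplesOn (C.filter fun c => c x = false) T e).ncard +
        (samplesOn (C.filter fun c => c x = true) T e).ncard) := by
  have hmem : ∀ {C' : ConceptClass X} {e' : ℕ} {S : LabeledSample X} (b : Bool),
      S ∈ samplesOn C' T e' → (x, b) ∉ S := fun b hS hb => hx (hS.2.1 _ hb)
  have hcard : ∀ b : Bool,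
      (insert (x, b) '' samplesOn (C.filter fun c => c x = b) T e).ncard =
        (samplesOn (C.filter fun c => c x = b) T e).ncard := by
    refine fun b => Set.InjOn.ncard_image fun S hS S' hS' h => ?_
    rw [← Finset.erase_insert (hmem b hS), ← Finset.erase_insert (hmem b hS')]
    exact congrArg (fun R => Finset.erase R (x, b)) h
  have hfin : ∀ b : Bool,
      (insert (x, b) '' samplesOn (C.filter fun c => c x = b) T e).Finite :=
    fun b => (finite_samplesOn _ T e).image _
  rw [samplesOn_insert C hx, Set.ncard_union_eq _ (finite_samplesOn _ _ _)
    ((hfin false).union (hfin true)), Set.ncard_union_eq _ (hfin false) (hfin true), hcard, hcard]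
  · rw [Set.disjoint_left]
    rintro _ ⟨S, hS, rfl⟩ ⟨S', hS', h⟩
    have h0 : (x, false) ∈ insert (x, true) S' := h ▸ Finset.mem_insert_self _ _
    rcases Finset.mem_insert.1 h0 with h0 | h0
    · simp at h0
    · exact hmem _ hS' h0
  · rw [Set.disjoint_left]
    rintro S hS (⟨S', -, rfl⟩ | ⟨S', -, rfl⟩)
    · exact hmem false hS (Finset.mem_insert_self _ _)
    · exact hmem true hS (Finset.mem_insert_self _ _)

/-! ### The lower bound for arbitrary classes -/

/-- A class whose concepts are distinguished by their values on `T` has at least as many samples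
over `T` as the weight sum of its size. -/
theorem weightSum_le_ncard_samplesOn {X : Type*} [DecidableEq X] (T : Finset X)
    (C : ConceptClass X) (hC : ∀ c ∈ C, ∀ c' ∈ C, (∀ x ∈ T, c x = c' x) → c = c') (e : ℕ) :
    weightSum (smallSupersets T.card e) C.card ≤ (samplesOn C T e).ncard := by
  induction T using Finset.induction_on generalizing C e with
  | empty =>
    rcases e with _ | e
    · simp [weightSum, smallSupersets, smallSubsets]
    have hle : C.card ≤ 1 := Finset.card_le_one.2 fun c hc c' hc' => hC c hc c' hc' (by simp)
    rcases C.eq_empty_or_nonempty with rfl | ⟨c, hc⟩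
    · simp [weightSum]
    · have h1 : C.card = 1 := le_antisymm hle (Finset.card_pos.2 ⟨c, hc⟩)
      have hpos : 0 < (samplesOn C ∅ (e + 1)).ncard := by
        rw [Set.ncard_pos (finite_samplesOn _ _ _)]
        exact ⟨∅, ⟨c, hc, by simp [Consistent]⟩, by simp, by simp⟩
      refine le_trans ?_ hpos
      simp [h1, weightSum, smallSupersets, smallSubsets, binarySum, Finset.sum_range_succ']
  | insert x T hx ih =>
    rcases e with _ | e
    · simp [weightSum, smallSupersets, smallSubsets]
    rw [ncard_samplesOn_insert C hx, Finset.card_insert_of_notMem hx]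
    have hsub : ∀ b : Bool, ∀ c ∈ C.filter (fun c => c x = b),
        ∀ c' ∈ C.filter (fun c => c x = b), (∀ y ∈ T, c y = c' y) → c = c' := by
      intro b c hc c' hc' h
      rw [Finset.mem_filter] at hc hc'
      refine hC c hc.1 c' hc'.1 fun y hy => ?_
      rcases Finset.mem_insert.1 hy with rfl | hy
      · exact hc.2.trans hc'.2.symm
      · exact h y hy
    have hmono : ∀ b : Bool, (samplesOn (C.filter fun c => c x = b) T (e + 1)).ncard ≤
        (samplesOn C T (e + 1)).ncard := fun b =>
      ncard_samplesOn_le (fun c hc => ⟨c, (Finset.mem_filter.1 hc).1, fun _ _ => rfl⟩) _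
    have hcard : C.card = (C.filter fun c => c x = false).card +
        (C.filter fun c => c x = true).card := by
      rw [← Finset.card_filter_add_card_filter_not (s := C) (fun c => c x = false)]
      simp
    -- The larger subclass carries the samples that avoid `x`.
    have step : ∀ {a b : ℕ}, b ≤ a →
        weightSum (smallSupersets (T.card + 1) (e + 1)) (a + b) ≤
          weightSum (smallSupersets T.card (e + 1)) a +
            (weightSum (smallSupersets T.card e) a + weightSum (smallSupersets T.card e) b) := by
      intro a b hba
      refine (weightSum_add_le hba (smallSupersets_antitone _ _)).trans ?_
      simp only [smallSupersets_succ_succ_succ]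
      rw [← add_assoc]
      refine Nat.add_le_add_right ?_ _
      unfold weightSum
      rw [← Finset.sum_add_distrib]
      exact Finset.sum_le_sum fun i _ => smallSupersets_succ_succ_le _ _ _
    have h0 := ih _ (hsub false) e
    have h1 := ih _ (hsub true) e
    have h0' := (ih _ (hsub false) (e + 1)).trans (hmono false)
    have h1' := (ih _ (hsub true) (e + 1)).trans (hmono true)
    rw [hcard]
    rcases le_total (C.filter fun c => c x = true).card (C.filter fun c => c x = false).card
      with h | h
    · have := step h
      omega
    · have := step h
      rw [add_comm (Finset.card (C.filter fun c => c x = false))]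
      omega

/-! ### The upper bound for the binary counting class -/

theorem mem_binaryCountingClass {k n : ℕ} {c : Fin n → Bool} :
    c ∈ binaryCountingClass k n ↔ ∃ i < k, (fun j : Fin n => i.testBit j) = c := by
  simp [binaryCountingClass]

theorem card_binaryCountingClass {k n : ℕ} (hkn : k ≤ 2 ^ n) :
    (binaryCountingClass k n).card = k := by
  unfold binaryCountingClass
  rw [Finset.card_image_of_injOn, Finset.card_range]
  intro i hi i' hi' h
  rw [Finset.mem_coe, Finset.mem_range] at hi hi'
  refine Nat.eq_of_testBit_eq fun j => ?_
  rcases lt_or_ge j n with hj | hj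
  · exact congrFun h ⟨j, hj⟩
  · have hpow : 2 ^ n ≤ 2 ^ j := Nat.pow_le_pow_right (by norm_num) hj
    rw [Nat.testBit_lt_two_pow (by omega), Nat.testBit_lt_two_pow (by omega)]

/-- On the `m` lowest bits, the binary counting class of size `k ≤ 2 ^ m` has at most as many
samples as its weight sum. -/
theorem ncard_samplesOn_binaryCountingClass_le {n m : ℕ} (hm : m ≤ n) {k : ℕ} (hk : k ≤ 2 ^ m)
    (e : ℕ) :
    (samplesOn (binaryCountingClass k n) (Finset.univ.filter fun j : Fin n => (j : ℕ) < m)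
      e).ncard ≤ weightSum (smallSupersets m e) k := by
  induction m generalizing k e with
  | zero =>
    rcases e with _ | e
    · simp [samplesOn_zero]
    rcases Nat.eq_zero_or_pos k with rfl | hk0
    · simp [samplesOn, Realizable, binaryCountingClass]
    · obtain rfl : k = 1 := le_antisymm (by simpa using hk) hk0
      have hsub : samplesOn (binaryCountingClass 1 n)
          (Finset.univ.filter fun j : Fin n => (j : ℕ) < 0) (e + 1) ⊆ {∅} := by
        intro S hS
        refine Finset.eq_empty_of_forall_notMem fun p hp => ?_
        simpa using hS.2.1 p hp
      refine (Set.ncard_le_ncard hsub).trans ?_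
      simp [weightSum, smallSupersets, smallSubsets, binarySum, Finset.sum_range_succ']
  | succ m ih =>
    rcases e with _ | e
    · simp [samplesOn_zero]
    have hT : (Finset.univ.filter fun j : Fin n => (j : ℕ) < m + 1) =
        insert ⟨m, hm⟩ (Finset.univ.filter fun j : Fin n => (j : ℕ) < m) := by
      ext j
      simp only [Finset.mem_filter, Finset.mem_univ, true_and, Finset.mem_insert, Fin.ext_iff]
      omega
    rw [hT, ncard_samplesOn_insert _ (by simp)]
    rw [pow_succ] at hk
    obtain ⟨a, b, rfl, ha, hb, hab⟩ :
        ∃ a b, k = a + b ∧ a ≤ 2 ^ m ∧ b ≤ 2 ^ m ∧ (a = 2 ^ m ∨ b = 0) :=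
      ⟨min k (2 ^ m), k - 2 ^ m, by omega, by omega, by omega, by omega⟩
    -- Reducing modulo `2 ^ m` keeps the low bits and sends `i < a + b` below `a`.
    have hall : (samplesOn (binaryCountingClass (a + b) n)
        (Finset.univ.filter fun j : Fin n => (j : ℕ) < m) (e + 1)).ncard ≤
          weightSum (smallSupersets m (e + 1)) a := by
      refine (ncard_samplesOn_le (fun c hc => ?_) _).trans (ih (by omega) ha (e + 1))
      obtain ⟨i, hi, rfl⟩ := mem_binaryCountingClass.1 hc
      refine ⟨_, mem_binaryCountingClass.2 ⟨i % 2 ^ m, ?_, rfl⟩, fun j hj => ?_⟩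
      · rcases hab with rfl | rfl
        · exact Nat.mod_lt _ (by positivity)
        · exact (Nat.mod_le _ _).trans_lt hi
      · simp [Nat.testBit_mod_two_pow, (Finset.mem_filter.1 hj).2]
    have hfalse : (samplesOn ((binaryCountingClass (a + b) n).filter
        fun c => c ⟨m, hm⟩ = false) (Finset.univ.filter fun j : Fin n => (j : ℕ) < m) e).ncard ≤
          weightSum (smallSupersets m e) a := by
      refine (ncard_samplesOn_le (fun c hc => ?_) _).trans (ih (by omega) ha e)
      obtain ⟨i, hi, rfl⟩ := mem_binaryCountingClass.1 (Finset.mem_filter.1 hc).1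
      refine ⟨_, mem_binaryCountingClass.2 ⟨i % 2 ^ m, ?_, rfl⟩, fun j hj => ?_⟩
      · rcases hab with rfl | rfl
        · exact Nat.mod_lt _ (by positivity)
        · exact (Nat.mod_le _ _).trans_lt hi
      · simp [Nat.testBit_mod_two_pow, (Finset.mem_filter.1 hj).2]
    have htrue : (samplesOn ((binaryCountingClass (a + b) n).filter
        fun c => c ⟨m, hm⟩ = true) (Finset.univ.filter fun j : Fin n => (j : ℕ) < m) e).ncard ≤
          weightSum (smallSupersets m e) b := by
      refine (ncard_samplesOn_le (fun c hc => ?_) _).trans (ih (by omega) hb e)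
      obtain ⟨hc, hbit⟩ := Finset.mem_filter.1 hc
      obtain ⟨i, hi, rfl⟩ := mem_binaryCountingClass.1 hc
      have hge : 2 ^ m ≤ i := Nat.ge_two_pow_of_testBit hbit
      refine ⟨_, mem_binaryCountingClass.2 ⟨i - 2 ^ m, by omega, rfl⟩, fun j hj => ?_⟩
      obtain ⟨i, rfl⟩ := Nat.exists_eq_add_of_le hge
      simp [Nat.testBit_two_pow_add_gt (Finset.mem_filter.1 hj).2]
    -- The top-bit split attains equality in `weightSum_add_le`.
    have hsplit : weightSum (smallSupersets (m + 1) (e + 1)) (a + b) =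
        weightSum (smallSupersets (m + 1) (e + 1)) a + weightSum (smallSupersets m e) b := by
      rcases hab with rfl | rfl
      · rw [weightSum_add_of_le_two_pow hb]
        simp only [smallSupersets_succ_succ_succ]
      · simp [weightSum]
    have hpascal : weightSum (smallSupersets (m + 1) (e + 1)) a =
        weightSum (smallSupersets m (e + 1)) a + weightSum (smallSupersets m e) a := by
      unfold weightSum
      rw [← Finset.sum_add_distrib]
      refine Finset.sum_congr rfl fun i hi => smallSupersets_succ_succ (binarySum_le ?_) e
      exact (Finset.mem_range.1 hi).trans_le ha
    omega

/-! ### Comparison of the two bounds -/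

theorem realizableSamples_eq_samplesOn {X : Type*} [Fintype X] (C : ConceptClass X) (d : ℕ) :
    realizableSamples C d = samplesOn C Finset.univ (d + 1) := by
  ext S
  simp [realizableSamples, samplesOn]

theorem mainTheorem9 (k n : ℕ) (hk : 2 ≤ k) (hkn : k ≤ 2 ^ n) :
    InFamily k n (binaryCountingClass k n) ∧
      ∀ (X : Type*) [Fintype X] (C : ConceptClass X),
        InFamily k n C → smnPrime C ≤ smnPrime (binaryCountingClass k n) := by
  classical
  refine ⟨⟨card_binaryCountingClass hkn, Fintype.card_fin n⟩, ?_⟩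
  rintro X _ C ⟨hC, hX⟩
  refine Nat.sInf_le ?_
  have h := (smnPrime_isLeast (binaryCountingClass k n)).1
  set d := smnPrime (binaryCountingClass k n)
  have hupper := ncard_samplesOn_binaryCountingClass_le le_rfl hkn (d + 1)
  have hlower := weightSum_le_ncard_samplesOn Finset.univ C
    (fun c _ c' _ h => funext fun x => h x (Finset.mem_univ x)) (d + 1)
  rw [Finset.card_univ, hX, hC, ← realizableSamples_eq_samplesOn] at hlower
  rw [Finset.filter_true_of_mem fun j _ => j.isLt, ← realizableSamples_eq_samplesOn] at hupper
  rw [Set.mem_ofPred_eq, card_binaryCountingClass hkn] at h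
  rw [Set.mem_ofPred_eq, hC]
  exact h.trans (hupper.trans hlower)
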